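/- **Setting.** Let $E$ be a finite-dimensional real normed space with norm $\|\cdot\|$ and dual norm $\|\cdot\|_*$. Consider $F(x)=f(x)+h(x)\to\min_{x\in Q}$, where $Q\subseteq E$ is closed and convex, $h$ is a known closed (lower semicontinuous) convex function on $Q$, and $f$ is a convex function on $Q$ with (sub)gradients $\nabla f$, such that $\|\nabla f(y)-\nabla f(x)\|_*\le L_\nu\|y-x\|^\nu$ for all $x,y\in Q$ and $\nu\in[0,1]$. Here $L_\nu\in[0,\infty]$, and $L_\nu<\infty$ for at least one $\nu$. Let $x_*$ be a minimizer of $F$ on $Q$ and $F_*=F(x_*)$. A $(\delta,L)$-oracle for $f$ returns for $x\in Q$ a pair $(f_{\delta,L}(x),g_{\delta,L}(x))\in\mathbb R\times E^*$ with $$0\le f(y)-f_{\delta,L}(x)-\langle g_{\delta,L}(x),y-x\rangle\le \tfrac L2\|y-x\|^2+\delta\qquad\text{for all } y\in Q .$$ The methods access $f$ only through a $(\delta,L)$-oracle with $\delta>0$ and $L=L(\delta)=\inf_{\nu\in[0,1]}L_\nu\Big[\frac{L_\nu}{2\delta}\frac{1-\nu}{1+\nu}\Big]^{\frac{1-\nu}{1+\nu}}$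 (for instance, the exact oracle $(f,\nabla f)$ is such an oracle for every $\delta>0$). A prox-function on $Q$ centred at $x^0\in Q$ is a continuous function $d\ge 0$ on $Q$ which is strongly convex on $Q$ with constant $1$ with respect to $\|\cdot\|$ and satisfies $d(x^0)=0$, $\nabla d(x^0)=0$; put $V(x,z)=d(x)-d(z)-\langle\nabla d(z),x-z\rangle$. For restarts it is assumed that for every $y\in Q$ the shifted function $d_y(x)=d(x-y+x^0)$ is a prox-function on $Q$ centred at $y$; with $V_y$ its Bregman distance, put $$\omega_n=\sup_{y\in Q}\ \sup_{x\in Q,\,x\ne y}\frac{2V_y(x,y)}{\|x-y\|^2},\qquad \omega_n<\infty .$$ A gradient scheme receives $Q$, $h$, a prox-function, a starting point, a numerical smoothness parameter $\Lambda>0$ and a number of iterations, and is then a deterministic method making one oracle call per iteration. Its *restarted version* makes $k$ successive runs with $n$ oracle calls each and with the same $\Lambda$: the first run starts at $x^0$ with prox-function $d$, and each following run starts at the output $y$ of the previous run with prox-function $d_y$. It makes $N=kn$ oracle calls and returns the output $y^N$ of the last run. **Statement.** There are absolute constants $C,c>0$ such that for every $p\in[0,1]$ and every $E$ there is a gradient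 scheme $\mathcal M$ on $E$ with both of the following properties. 1. (Intermediate rate for convex problems.) For all $Q$, $h$, $d$, $x^0$, $(L_\nu)_\nu$ as above (no shifts of $d$ are needed here) and all $R\ge0$, $\varepsilon>0$ there are $\Lambda>0$ and an integer $N\ge 1$ with $$N\le C\max\Big\{1,\ \inf_{\nu\in[0,1]}\Big(\frac{L_\nu R^{1+\nu}}{\varepsilon}\Big)^{\frac{2}{1+2p\nu+\nu}}\Big\}$$ such that $N$ iterations of $\mathcal M$ return $y^N\in Q$ with $F(y^N)-F_*\le\varepsilon$, for every $f$ as above with $V(x_*,x^0)\le R^2$ and every oracle as above with $0<\delta\le c\,\varepsilon/N^p$. 2. (Restarts for strongly convex problems.) For all $Q$, $h$, $d$, $x^0$, $(L_\nu)_\nu$ as above and all $\mu>0$, $R\ge 0$, $\varepsilon>0$ there are $\Lambda>0$ and integers $n,k\ge1$ such that $N=kn$ satisfies $$N\le C\,\max\Big\{1,\ \inf_{\nu\in[0,1]}\Big(\frac{L_\nu^{\frac{2}{1+\nu}}\,\omega_n}{\mu\,\varepsilon^{\frac{1-\nu}{1+\nu}}}\Big)^{\frac{1+\nu}{1+2p\nu+\nu}}\Big\}\cdot\max\Big\{1,\Big\lceil\ln\frac{\mu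 R^2}{\varepsilon}\Big\rceil\Big\}$$ (the second maximum is $1$ if $R=0$), and the restarted version of $\mathcal M$ ($k$ runs of $n$ iterations) returns $y^N\in Q$ with $F(y^N)-F_*\le\varepsilon$, for every $f$ as above such that $F$ is $\mu$-strongly convex on $Q$ with respect to $\|\cdot\|$ and $\|x^0-x_*\|\le R$, and for every oracle as above with $0<\delta\le c\,\varepsilon/N^p$. -/

import Mathlib

open scoped ENNReal

noncomputable section

/-! ## Oracle methods -/

/-- The answer of a first-order oracle at a point: a number and a linear functional. -/
abbrev OracleAnswer (E : Type*) [NormedAddCommGroup E] [NormedSpace ℝ E] : Type _ :=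
  ℝ × (E →L[ℝ] ℝ)

/-- A deterministic first-order method. The next query point and the final output are functions of
the list of the oracle's answers received so far, and of nothing else. -/
structure OracleMethod (E : Type*) [NormedAddCommGroup E] [NormedSpace ℝ E] where
  query : List (OracleAnswer E) → E
  output : List (OracleAnswer E) → E

/-- The answers received in the first `n` calls of the oracle `O`. -/
def OracleMethod.transcript {E : Type*} [NormedAddCommGroup E] [NormedSpace ℝ E]
    (A : OracleMethod E) (O : E → OracleAnswer E) : ℕ → List (OracleAnswer E)
  | 0 => []
  | n + 1 => A.transcript O n ++ [O (A.query (A.transcript O n))]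

/-- What the method returns after exactly `n` calls of the oracle `O`. -/
def OracleMethod.run {E : Type*} [NormedAddCommGroup E] [NormedSpace ℝ E]
    (A : OracleMethod E) (O : E → OracleAnswer E) (n : ℕ) : E :=
  A.output (A.transcript O n)

/-- A scheme of gradient methods for `f + h → min` over `Q`. It is given the feasible set `Q`, the
composite term `h`, a prox-function `d`, the starting point, a smoothness parameter (a number) and
the number of iterations; `f` is accessible through the oracle only. -/
abbrev GradientScheme (E : Type*) [NormedAddCommGroup E] [NormedSpace ℝ E] : Type _ :=
  (Q : Set E) → (h : E → ℝ) → (d : E → ℝ) → (start : E) → (smoothness : ℝ) → (n : ℕ) →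
    OracleMethod E

/-! ## Prox-functions -/

/-- The Bregman distance `V(x, z) = d(x) - d(z) - ⟨∇d(z), x - z⟩` for `x, z ∈ Q`. -/
def bregman {E : Type*} [NormedAddCommGroup E] [NormedSpace ℝ E]
    (Q : Set E) (d : E → ℝ) (x z : E) : ℝ :=
  d x - d z - fderivWithin ℝ d Q z (x - z)

/-- `d` is a prox-function on `Q` centred at `x₀ ∈ Q`. -/
structure IsProxFunction {E : Type*} [NormedAddCommGroup E] [NormedSpace ℝ E]
    (Q : Set E) (d : E → ℝ) (x₀ : E) : Prop where
  center_mem : x₀ ∈ Q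
  continuousOn : ContinuousOn d Q
  strongConvexOn : StrongConvexOn Q 1 d
  nonneg : ∀ x ∈ Q, 0 ≤ d x
  center_eq_zero : d x₀ = 0
  grad_center_eq_zero : HasFDerivWithinAt d (0 : E →L[ℝ] ℝ) Q x₀

/-- The prox-function `x ↦ d(x - y + x₀)`, recentred from `x₀` to `y`. -/
def shiftProx {E : Type*} [NormedAddCommGroup E] [NormedSpace ℝ E]
    (d : E → ℝ) (x₀ y : E) : E → ℝ :=
  fun x => d (x - y + x₀)

/-- `sup_{x ∈ Q} 2 V(x, x₀) / ‖x - x₀‖²`; the term `x = x₀` contributes `0`. -/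
def proxRatio {E : Type*} [NormedAddCommGroup E] [NormedSpace ℝ E]
    (Q : Set E) (d : E → ℝ) (x₀ : E) : ℝ≥0∞ :=
  ⨆ x ∈ Q, ENNReal.ofReal (2 * bregman Q d x x₀ / ‖x - x₀‖ ^ 2)

/-- The constant `ω`: the ratio above for the prox-function recentred at any point `y ∈ Q` from
which the method may be restarted (`y = x₀` is the original prox-function). -/
def restartRatio {E : Type*} [NormedAddCommGroup E] [NormedSpace ℝ E]
    (Q : Set E) (d : E → ℝ) (x₀ : E) : ℝ≥0∞ :=
  ⨆ y ∈ Q, proxRatio Q (shiftProx d x₀ y) y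

/-! ## Restarts -/

/-- `restarted M Q h d x₀ Λ n O k` is the point obtained from `x₀` by `k` successive runs of the
scheme `M` with `n` oracle calls each (`k * n` calls altogether); every run starts at the output
`y` of the previous one and uses the prox-function recentred at `y`. -/
def restarted {E : Type*} [NormedAddCommGroup E] [NormedSpace ℝ E]
    (M : GradientScheme E) (Q : Set E) (h d : E → ℝ) (x₀ : E) (Λ : ℝ) (n : ℕ)
    (O : E → OracleAnswer E) : ℕ → E
  | 0 => x₀
  | k + 1 =>
    (M Q h (shiftProx d x₀ (restarted M Q h d x₀ Λ n O k))
      (restarted M Q h d x₀ Λ n O k) Λ n).run O n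

/-! ## The problem class -/

/-- The known part of the problem: a closed convex set and a closed convex function on it. -/
structure IsCompositeData {E : Type*} [NormedAddCommGroup E] [NormedSpace ℝ E]
    (Q : Set E) (h : E → ℝ) : Prop where
  isClosed : IsClosed Q
  convexOn : ConvexOn ℝ Q h
  lowerSemicontinuousOn : LowerSemicontinuousOn h Q

/-- `f` is convex on `Q`, `G` is its gradient (a selection of subgradients where `f` is not
differentiable), and `‖G y - G x‖_* ≤ L_ν ‖y - x‖ ^ ν` on `Q` for all `ν ∈ [0, 1]`. The value
`L_ν = ∞` means that nothing is assumed for this `ν`. -/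
structure IsHolderPart {E : Type*} [NormedAddCommGroup E] [NormedSpace ℝ E]
    (Q : Set E) (f : E → ℝ) (G : E → E →L[ℝ] ℝ) (L : ℝ → ℝ≥0∞) : Prop where
  convexOn : ConvexOn ℝ Q f
  subgradient : ∀ x ∈ Q, ∀ y ∈ Q, f x + G x (y - x) ≤ f y
  holder : ∀ ν ∈ Set.Icc (0 : ℝ) 1, ∀ x ∈ Q, ∀ y ∈ Q, ‖G y - G x‖ₑ ≤ L ν * ‖y - x‖ₑ ^ ν

/-- `O` is a `(δ, Λ)`-oracle for `f` on `Q`. -/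
def IsInexactOracle {E : Type*} [NormedAddCommGroup E] [NormedSpace ℝ E]
    (Q : Set E) (f : E → ℝ) (δ Λ : ℝ) (O : E → OracleAnswer E) : Prop :=
  ∀ x ∈ Q, ∀ y ∈ Q,
    0 ≤ f y - (O x).1 - (O x).2 (y - x) ∧
      f y - (O x).1 - (O x).2 (y - x) ≤ Λ / 2 * ‖y - x‖ ^ 2 + δ

/-- `inf_{ν ∈ [0,1]} L_ν [ (L_ν / (2δ)) (1-ν)/(1+ν) ] ^ ((1-ν)/(1+ν))`. -/
def effectiveSmoothness (L : ℝ → ℝ≥0∞) (δ : ℝ) : ℝ≥0∞ :=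
  ⨅ ν ∈ Set.Icc (0 : ℝ) 1,
    L ν * (L ν / ENNReal.ofReal (2 * δ) * ENNReal.ofReal ((1 - ν) / (1 + ν))) ^
      ((1 - ν) / (1 + ν))

/-! ## The complexity bounds -/

/-- `inf_{ν ∈ [0,1]} (L_ν R^{1+ν} / ε) ^ (2 / (1 + 2pν + ν))`. -/
def convexComplexity (p : ℝ) (L : ℝ → ℝ≥0∞) (R ε : ℝ) : ℝ≥0∞ :=
  ⨅ ν ∈ Set.Icc (0 : ℝ) 1,
    (L ν * ENNReal.ofReal (R ^ (1 + ν)) / ENNReal.ofReal ε) ^ (2 / (1 + 2 * p * ν + ν))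

/-- `inf_{ν ∈ [0,1]} (L_ν^{2/(1+ν)} ω / (μ ε^{(1-ν)/(1+ν)})) ^ ((1+ν) / (1 + 2pν + ν))`. -/
def stronglyConvexComplexity (p : ℝ) (L : ℝ → ℝ≥0∞) (ω : ℝ≥0∞) (μ ε : ℝ) : ℝ≥0∞ :=
  ⨅ ν ∈ Set.Icc (0 : ℝ) 1,
    (L ν ^ (2 / (1 + ν)) * ω / ENNReal.ofReal (μ * ε ^ ((1 - ν) / (1 + ν)))) ^
      ((1 + ν) / (1 + 2 * p * ν + ν))

/-- The scheme `M` has the intermediate rate with exponent `p` on convex composite problems, with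
constants `C` and `c`: `F(y^N) - F_* ≤ ε`, `N ≤ C max(1, inf_ν …)`, for every inexactness
`δ ≤ c ε / N ^ p`. Here `R² ≥ V(x_*, x₀)`. -/
def HasIntermediateRate {E : Type*} [NormedAddCommGroup E] [NormedSpace ℝ E]
    (p C c : ℝ) (M : GradientScheme E) : Prop :=
  ∀ (Q : Set E) (h d : E → ℝ) (x₀ : E) (L : ℝ → ℝ≥0∞) (R ε : ℝ),
    IsCompositeData Q h → IsProxFunction Q d x₀ →
    (∃ ν ∈ Set.Icc (0 : ℝ) 1, L ν ≠ ∞) → 0 ≤ R → 0 < ε →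
    ∃ (Λ : ℝ) (N : ℕ), 0 < Λ ∧ 0 < N ∧
      (N : ℝ≥0∞) ≤ ENNReal.ofReal C * max 1 (convexComplexity p L R ε) ∧
      ∀ (f : E → ℝ) (G : E → E →L[ℝ] ℝ) (xs : E) (δ : ℝ) (O : E → OracleAnswer E),
        IsHolderPart Q f G L →
        xs ∈ Q → IsMinOn (fun x => f x + h x) Q xs → bregman Q d xs x₀ ≤ R ^ 2 →
        0 < δ → δ ≤ c * ε / (N : ℝ) ^ p →
        IsInexactOracle Q f δ (effectiveSmoothness L δ).toReal O →
        (M Q h d x₀ Λ N).run O N ∈ Q ∧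
          (f ((M Q h d x₀ Λ N).run O N) + h ((M Q h d x₀ Λ N).run O N)) - (f xs + h xs) ≤ ε

/-- The restarted scheme `M` has the following rate on composite problems with a `μ`-strongly convex
objective, with constants `C` and `c`: `F(y^N) - F_* ≤ ε` after `N = k * n` oracle calls (`k` runs
of `n` calls), `N ≤ C max(1, inf_ν …) max(1, ⌈ln(μR²/ε)⌉)`, for every inexactness
`δ ≤ c ε / N ^ p`. Here `R ≥ ‖x₀ - x_*‖`. -/
def HasRestartRate {E : Type*} [NormedAddCommGroup E] [NormedSpace ℝ E]
    (p C c : ℝ) (M : GradientScheme E) : Prop :=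
  ∀ (Q : Set E) (h d : E → ℝ) (x₀ : E) (L : ℝ → ℝ≥0∞) (μ R ε : ℝ),
    IsCompositeData Q h → x₀ ∈ Q → (∀ y ∈ Q, IsProxFunction Q (shiftProx d x₀ y) y) →
    restartRatio Q d x₀ ≠ ∞ →
    (∃ ν ∈ Set.Icc (0 : ℝ) 1, L ν ≠ ∞) → 0 < μ → 0 ≤ R → 0 < ε →
    ∃ (Λ : ℝ) (n k : ℕ), 0 < Λ ∧ 0 < n ∧ 0 < k ∧
      ((k * n : ℕ) : ℝ≥0∞) ≤
        ENNReal.ofReal C * max 1 (stronglyConvexComplexity p L (restartRatio Q d x₀) μ ε) *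
          ((max 1 ⌈Real.log (μ * R ^ 2 / ε)⌉₊ : ℕ) : ℝ≥0∞) ∧
      ∀ (f : E → ℝ) (G : E → E →L[ℝ] ℝ) (xs : E) (δ : ℝ) (O : E → OracleAnswer E),
        IsHolderPart Q f G L → StrongConvexOn Q μ (fun x => f x + h x) →
        xs ∈ Q → IsMinOn (fun x => f x + h x) Q xs → ‖x₀ - xs‖ ≤ R →
        0 < δ → δ ≤ c * ε / ((k * n : ℕ) : ℝ) ^ p →
        IsInexactOracle Q f δ (effectiveSmoothness L δ).toReal O →
        restarted M Q h d x₀ Λ n O k ∈ Q ∧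
          (f (restarted M Q h d x₀ Λ n O k) + h (restarted M Q h d x₀ Λ n O k))
            - (f xs + h xs) ≤ ε

end

/-!
The scheme is one accelerated method with a tunable weight sequence. It keeps a model
`d + ∑ (aᵢ / Λ) (ℓᵢ + h)` of the objective, where `ℓᵢ` is the affine minorant of `f` given by the
`i`-th answer of the oracle, together with the minimizer `z` of the model over `Q` and an average `y` of
these minimizers with weights `aᵢ`. With `A` the sum of the previous weights and `a` the current
one, the oracle is queried at `(1 - 1 / a) y + (1 / a) z`, and `y` moves to
`(A y + a z') / (A + a)`, where `z'` is the new minimizer. The classical accelerated method has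
`a / (A + a)` in place of `1 / a`; the present choice makes the error of an answer enter with the
weight `a ^ 2` instead of `A + a` (`weighted_objective_le`). The only conditions are `1 ≤ a` and
`a ^ 2 ≤ A + a`, and they hold for `aᵢ = ((i + 2) / 2) ^ p`. As `A` grows like `N ^ (p + 1)` and
`∑ aᵢ ^ 2` at most like `N ^ (2 p + 1)`, a `(D, Λ)`-oracle yields the gap
`4 Λ d(x_*) / N ^ (p + 1) + 4 N ^ p D` (`intermediateMethod_gap_le`).

The parameter `Λ` has to be fixed before `δ` is known, and the effective smoothness grows as `δ`
decreases. This does no harm: every oracle with `δ ≤ δ₀` is a `(4 δ₀, 3 Λ₀)`-oracle, where `Λ₀` is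
the term of the effective smoothness at `δ₀` for any one exponent `ν` with `L ν < ∞`
(`IsInexactOracle.of_le`). With `δ₀ = ε / (64 N ^ p)` and `ν` nearly attaining the infimum in the
complexity bound, the gap is at most `ε` for the stated `N` (`holderSmoothness_mul_le`,
`exists_smoothness_run_le`).

For a `μ`-strongly convex objective the prox-function satisfies `d_y(x_*) ≤ ω / 2 * ‖x_* - y‖ ^ 2`,
and `μ / 2 * ‖y - x_*‖ ^ 2` is at most the gap at `y`. Hence each run divides the gap by `4` up to
an error `ε / 4`, and `max 1 ⌈ln (μ R ^ 2 / ε)⌉` runs suffice (`restarted_gap_le`).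
-/

/-! ### Minimizers of strongly convex functions -/

/-- A strongly convex function grows quadratically away from its minimizer. -/
theorem StrongConvexOn.add_sq_le_of_isMinOn {E : Type*} [NormedAddCommGroup E] [NormedSpace ℝ E]
    {Q : Set E} {m : ℝ} {φ : E → ℝ} (hφ : StrongConvexOn Q m φ) {z x : E} (hz : z ∈ Q)
    (hmin : IsMinOn φ Q z) (hx : x ∈ Q) : φ z + m / 2 * ‖x - z‖ ^ 2 ≤ φ x := by
  set r := m / 2 * ‖x - z‖ ^ 2 with hr
  -- compare `φ z` with `φ` at `(1 - t) • z + t • x` and let `t → 0`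
  have key : ∀ t ∈ Set.Ioo (0 : ℝ) 1, φ z + (1 - t) * r ≤ φ x := by
    rintro t ⟨ht0, ht1⟩
    have h1 := hφ.2 hx hz ht0.le (sub_nonneg.2 ht1.le) (by ring)
    have h2 : φ z ≤ φ (t • x + (1 - t) • z) :=
      hmin (hφ.1 hx hz ht0.le (sub_nonneg.2 ht1.le) (by ring))
    simp only [smul_eq_mul] at h1
    have h3 : t * (φ z + (1 - t) * r) ≤ t * φ x := by rw [hr]; linarith
    exact le_of_mul_le_mul_left h3 ht0
  have hlim : Filter.Tendsto (fun t : ℝ => φ z + (1 - t) * r) (nhdsWithin 0 (Set.Ioi 0))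
      (nhds (φ z + (1 - 0) * r)) := by
    refine Filter.Tendsto.mono_left ?_ nhdsWithin_le_nhds
    exact Continuous.tendsto (by fun_prop) 0
  have h := le_of_tendsto hlim
    (Filter.mem_of_superset (Ioo_mem_nhdsGT (zero_lt_one' ℝ)) key)
  linarith

/-- Coercivity: on the unit ball a lower bound comes from compactness, and strong convexity along
rays carries it to all of `Q` with a quadratic gain, so that the minimum over a large ball is
global. -/
theorem StrongConvexOn.exists_isMinOn {E : Type*} [NormedAddCommGroup E] [NormedSpace ℝ E]
    [FiniteDimensional ℝ E] {Q : Set E} {φ : E → ℝ} (hφ : StrongConvexOn Q 1 φ)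
    (hQ : IsClosed Q) (hne : Q.Nonempty) (hlsc : LowerSemicontinuousOn φ Q) :
    ∃ z ∈ Q, IsMinOn φ Q z := by
  have : ProperSpace E := FiniteDimensional.proper ℝ E
  obtain ⟨x₀, hx₀⟩ := hne
  have hball : ∀ r : ℝ, 0 ≤ r → ∃ z ∈ Q ∩ Metric.closedBall x₀ r,
      IsMinOn φ (Q ∩ Metric.closedBall x₀ r) z := fun r hr =>
    LowerSemicontinuousOn.exists_isMinOn ⟨x₀, hx₀, Metric.mem_closedBall_self hr⟩
      ((isCompact_closedBall x₀ r).inter_left hQ) (hlsc.mono Set.inter_subset_left)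
  obtain ⟨u, -, hu⟩ := hball 1 zero_le_one
  have hux : φ u ≤ φ x₀ := hu ⟨hx₀, Metric.mem_closedBall_self zero_le_one⟩
  set r := 1 + 2 * (φ x₀ - φ u) with hr
  have hr1 : 1 ≤ r := by linarith
  obtain ⟨z, ⟨hzQ, -⟩, hz⟩ := hball r (by linarith)
  refine ⟨z, hzQ, fun x hx => ?_⟩
  by_cases hxr : ‖x - x₀‖ ≤ r
  · exact hz ⟨hx, by simpa [dist_eq_norm] using hxr⟩
  have hz0 : φ z ≤ φ x₀ := hz ⟨hx₀, Metric.mem_closedBall_self (by linarith)⟩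
  refine hz0.trans ?_
  push Not at hxr
  set s := ‖x - x₀‖ with hs
  have hs0 : 0 < s := by linarith
  have hs1 : s⁻¹ ≤ 1 := inv_le_one_of_one_le₀ (by linarith)
  have hmem := hφ.1 hx hx₀ (inv_nonneg.2 hs0.le) (sub_nonneg.2 hs1) (by ring)
  have h1 := hφ.2 hx hx₀ (inv_nonneg.2 hs0.le) (sub_nonneg.2 hs1) (by ring)
  have h2 : φ u ≤ φ (s⁻¹ • x + (1 - s⁻¹) • x₀) := by
    refine hu ⟨hmem, ?_⟩
    have : s⁻¹ • x + (1 - s⁻¹) • x₀ - x₀ = s⁻¹ • (x - x₀) := by module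
    rw [Metric.mem_closedBall, dist_eq_norm, this, norm_smul, Real.norm_of_nonneg
      (inv_nonneg.2 hs0.le), ← hs, inv_mul_cancel₀ hs0.ne']
  simp only [smul_eq_mul, ← hs] at h1
  have h3 : s * φ u ≤ φ x + (s - 1) * φ x₀ - (s - 1) * (s / 2) := by
    have := mul_le_mul_of_nonneg_left (h2.trans h1) hs0.le
    have e : s * (s⁻¹ * φ x + (1 - s⁻¹) * φ x₀ - s⁻¹ * (1 - s⁻¹) * (1 / 2 * s ^ 2))
        = φ x + (s - 1) * φ x₀ - (s - 1) * (s / 2) := by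
      field_simp
    linarith
  nlinarith [mul_nonneg hs0.le (sub_nonneg.2 hxr.le)]

/-! ### Weights -/

/-- The weight of the answer number `i`, counted from `0`. The first weight is `1`, and the base
grows by `1 / 2` per step, slowly enough for `stepWeight_sq_le`. -/
noncomputable def stepWeight (p : ℝ) (i : ℕ) : ℝ := (((i : ℝ) + 2) / 2) ^ p

/-- The sum of the first `k` weights. -/
noncomputable def totalWeight (p : ℝ) (k : ℕ) : ℝ := ∑ i ∈ Finset.range k, stepWeight p i

theorem totalWeight_succ (p : ℝ) (k : ℕ) :
    totalWeight p (k + 1) = totalWeight p k + stepWeight p k :=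
  Finset.sum_range_succ _ _

theorem one_le_stepWeight {p : ℝ} (hp : 0 ≤ p) (i : ℕ) : 1 ≤ stepWeight p i :=
  Real.one_le_rpow (by have : (0 : ℝ) ≤ i := i.cast_nonneg; linarith) hp

theorem totalWeight_nonneg {p : ℝ} (hp : 0 ≤ p) (k : ℕ) : 0 ≤ totalWeight p k :=
  Finset.sum_nonneg fun i _ => zero_le_one.trans (one_le_stepWeight hp i)

/-- `t ↦ t ^ p` grows by at most `1 / 2` over a step of length `1 / 2` in `[1, ∞)`. -/
theorem stepWeight_succ_le {p : ℝ} (hp0 : 0 ≤ p) (hp1 : p ≤ 1) (i : ℕ) :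
    stepWeight p (i + 1) ≤ stepWeight p i + 1 / 2 := by
  have hi : (0 : ℝ) ≤ i := i.cast_nonneg
  set t : ℝ := ((i : ℝ) + 2) / 2 with ht
  have ht1 : 1 ≤ t := by rw [ht]; linarith
  have e : (((i + 1 : ℕ) : ℝ) + 2) / 2 = t * (1 + 1 / (2 * t)) := by
    rw [mul_add, mul_one, mul_one_div, div_mul_cancel_right₀ (by linarith)]
    push_cast; rw [ht]; ring
  have hb : (1 + 1 / (2 * t)) ^ p ≤ 1 + p * (1 / (2 * t)) :=
    rpow_one_add_le_one_add_mul_self (by have : 0 ≤ 1 / (2 * t) := by positivity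
                                         linarith) hp0 hp1
  have htp : t ^ p ≤ t := by
    simpa using Real.rpow_le_rpow_of_exponent_le ht1 hp1
  have htp0 : 0 ≤ t ^ p := by positivity
  unfold stepWeight
  rw [e, ← ht, Real.mul_rpow (by linarith) (by positivity)]
  have h1 : p * (1 / (2 * t)) ≤ 1 / (2 * t) := mul_le_of_le_one_left (by positivity) hp1
  have h2 : t ^ p * (1 / (2 * t)) ≤ t * (1 / (2 * t)) :=
    mul_le_mul_of_nonneg_right htp (by positivity)
  have h3 : t * (1 / (2 * t)) = 1 / 2 := by field_simp
  calc t ^ p * (1 + 1 / (2 * t)) ^ p ≤ t ^ p * (1 + 1 / (2 * t)) :=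
        mul_le_mul_of_nonneg_left (by linarith) htp0
    _ ≤ t ^ p + 1 / 2 := by linarith

theorem stepWeight_sq_le {p : ℝ} (hp0 : 0 ≤ p) (hp1 : p ≤ 1) (k : ℕ) :
    stepWeight p k ^ 2 ≤ totalWeight p k + stepWeight p k := by
  induction k with
  | zero => simp [totalWeight, stepWeight]
  | succ k ih =>
    have h1 := stepWeight_succ_le hp0 hp1 k
    have h2 := one_le_stepWeight hp0 k
    have h3 := one_le_stepWeight hp0 (k + 1)
    rw [totalWeight_succ]
    by_cases hle : stepWeight p k ≤ stepWeight p (k + 1)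
    · nlinarith
    · nlinarith

/-- Each weight is at least `(i + 1) ^ p / 2`, and `t ^ p ≥ t` on `[0, 1]`. -/
theorem rpow_div_four_le_totalWeight {p : ℝ} (hp0 : 0 ≤ p) (hp1 : p ≤ 1) {N : ℕ} (hN : 0 < N) :
    (N : ℝ) ^ (p + 1) / 4 ≤ totalWeight p N := by
  have hN0 : (0 : ℝ) < N := by exact_mod_cast hN
  have hterm : ∀ i ∈ Finset.range N,
      (N : ℝ) ^ p / 2 * (((i : ℝ) + 1) / N) ≤ stepWeight p i := by
    intro i hi
    have hi0 : (0 : ℝ) ≤ i := i.cast_nonneg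
    have hiN : (i : ℝ) + 1 ≤ N := by exact_mod_cast Finset.mem_range.1 hi
    set t : ℝ := ((i : ℝ) + 1) / N with ht
    have ht0 : 0 < t := by positivity
    have ht1 : t ≤ 1 := (div_le_one hN0).2 hiN
    have h1 : t ≤ t ^ p := by
      simpa using Real.rpow_le_rpow_of_exponent_ge ht0 ht1 hp1
    have h2 : (N : ℝ) ^ p * t ^ p = ((i : ℝ) + 1) ^ p := by
      rw [← Real.mul_rpow hN0.le ht0.le, ht, mul_div_cancel₀ _ hN0.ne']
    have h3 : ((i : ℝ) + 1) ^ p ≤ 2 * stepWeight p i := by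
      have e : stepWeight p i = ((i : ℝ) + 2) ^ p / 2 ^ p :=
        Real.div_rpow (by linarith) (by norm_num) p
      have h4 : (2 : ℝ) ^ p ≤ 2 := by
        simpa using Real.rpow_le_rpow_of_exponent_le (one_le_two : (1 : ℝ) ≤ 2) hp1
      have h5 : ((i : ℝ) + 2) ^ p = stepWeight p i * 2 ^ p := by
        rw [e, div_mul_cancel₀ _ (by positivity)]
      have h6 : ((i : ℝ) + 1) ^ p ≤ ((i : ℝ) + 2) ^ p :=
        Real.rpow_le_rpow (by linarith) (by linarith) hp0
      have h7 := one_le_stepWeight hp0 i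
      nlinarith
    have h8 := mul_le_mul_of_nonneg_left h1 (Real.rpow_nonneg hN0.le p)
    linarith
  have hsum : ∑ i ∈ Finset.range N, ((i : ℝ) + 1) = N * (N + 1) / 2 := by
    clear hterm hN hN0
    induction N with
    | zero => simp
    | succ n ih => rw [Finset.sum_range_succ, ih]; push_cast; ring
  calc (N : ℝ) ^ (p + 1) / 4 = (N : ℝ) ^ p * N / 4 := by
        rw [Real.rpow_add hN0, Real.rpow_one]
    _ ≤ (N : ℝ) ^ p * (N + 1) / 4 := by gcongr; linarith
    _ = (N : ℝ) ^ p / 2 * ((∑ i ∈ Finset.range N, ((i : ℝ) + 1)) / N) := by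
        rw [hsum]; field_simp; norm_num
    _ = ∑ i ∈ Finset.range N, (N : ℝ) ^ p / 2 * (((i : ℝ) + 1) / N) := by
        rw [Finset.sum_div, Finset.mul_sum]
    _ ≤ totalWeight p N := Finset.sum_le_sum hterm

theorem sum_stepWeight_sq_le {p : ℝ} (hp0 : 0 ≤ p) {N : ℕ} :
    ∑ i ∈ Finset.range N, stepWeight p i ^ 2 ≤ N * ((N : ℝ) ^ p) ^ 2 := by
  have hterm : ∀ i ∈ Finset.range N, stepWeight p i ^ 2 ≤ ((N : ℝ) ^ p) ^ 2 := by
    intro i hi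
    have hi0 : (0 : ℝ) ≤ i := i.cast_nonneg
    have hiN : (i : ℝ) + 1 ≤ N := by exact_mod_cast Finset.mem_range.1 hi
    have h1 := one_le_stepWeight hp0 i
    exact pow_le_pow_left₀ (zero_le_one.trans h1)
      (Real.rpow_le_rpow (by linarith) (by linarith) hp0) 2
  simpa using Finset.sum_le_card_nsmul _ _ _ hterm

/-! ### The intermediate gradient method -/

section Method

/-- A minimizer of `φ` over `Q`, if there is one. -/
noncomputable def argminOn {α : Type*} [Nonempty α] (Q : Set α) (φ : α → ℝ) : α :=
  Classical.epsilon fun z => z ∈ Q ∧ IsMinOn φ Q z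

theorem argminOn_spec {α : Type*} [Nonempty α] {Q : Set α} {φ : α → ℝ}
    (h : ∃ z ∈ Q, IsMinOn φ Q z) :
    argminOn Q φ ∈ Q ∧ IsMinOn φ Q (argminOn Q φ) :=
  Classical.epsilon_spec h

variable {E : Type*} [NormedAddCommGroup E] [NormedSpace ℝ E]

/-- What the method remembers: the number of answers received, the current approximate solution
`avg`, the model of the objective accumulated so far (prox-function included), and its minimizer
`center` over the feasible set. -/
structure MethodState (E : Type*) where
  count : ℕ
  avg : E
  center : E
  model : E → ℝ

/-- The next query point `(1 - 1 / a) y + (1 / a) z`, with `a` the current weight. -/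
noncomputable def MethodState.queryPoint (p : ℝ) (s : MethodState E) : E :=
  (1 - (stepWeight p s.count)⁻¹) • s.avg + (stepWeight p s.count)⁻¹ • s.center

/-- The model after one more answer of the oracle. -/
noncomputable def MethodState.nextModel (p : ℝ) (h : E → ℝ) (Λ : ℝ) (s : MethodState E)
    (ans : OracleAnswer E) : E → ℝ :=
  fun x => s.model x + stepWeight p s.count / Λ * (ans.1 + ans.2 (x - s.queryPoint p) + h x)

/-- One iteration: the answer is added to the model, the model is minimized, and the minimizer is
averaged into the approximate solution. -/
noncomputable def MethodState.next (p : ℝ) (Q : Set E) (h : E → ℝ) (Λ : ℝ) (s : MethodState E)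
    (ans : OracleAnswer E) : MethodState E where
  count := s.count + 1
  avg := (totalWeight p s.count / totalWeight p (s.count + 1)) • s.avg +
    (stepWeight p s.count / totalWeight p (s.count + 1)) • argminOn Q (s.nextModel p h Λ ans)
  center := argminOn Q (s.nextModel p h Λ ans)
  model := s.nextModel p h Λ ans

/-- The intermediate gradient method with exponent `p`. It does not use the number of iterations
that it is given. -/
noncomputable def intermediateMethod (p : ℝ) (E : Type*) [NormedAddCommGroup E]
    [NormedSpace ℝ E] : GradientScheme E :=
  fun Q h d start Λ _ =>
    { query := fun l =>
        (l.foldl (MethodState.next p Q h Λ) ⟨0, start, start, d⟩).queryPoint p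
      output := fun l => (l.foldl (MethodState.next p Q h Λ) ⟨0, start, start, d⟩).avg }

/-- The states of the method run against the oracle `O`. -/
noncomputable def methodState (p : ℝ) (Q : Set E) (h d : E → ℝ) (start : E) (Λ : ℝ)
    (O : E → OracleAnswer E) : ℕ → MethodState E
  | 0 => ⟨0, start, start, d⟩
  | k + 1 => (methodState p Q h d start Λ O k).next p Q h Λ
      (O ((methodState p Q h d start Λ O k).queryPoint p))

theorem foldl_transcript_intermediateMethod (p : ℝ) (Q : Set E) (h d : E → ℝ) (start : E) (Λ : ℝ)
    (n : ℕ) (O : E → OracleAnswer E) (k : ℕ) :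
    ((intermediateMethod p E Q h d start Λ n).transcript O k).foldl (MethodState.next p Q h Λ)
      ⟨0, start, start, d⟩ = methodState p Q h d start Λ O k := by
  induction k with
  | zero => rfl
  | succ k ih =>
    rw [OracleMethod.transcript, List.foldl_append, ih, methodState, ← ih]
    rfl

theorem intermediateMethod_run (p : ℝ) (Q : Set E) (h d : E → ℝ) (start : E) (Λ : ℝ)
    (n : ℕ) (O : E → OracleAnswer E) (k : ℕ) :
    (intermediateMethod p E Q h d start Λ n).run O k =
      (methodState p Q h d start Λ O k).avg := by
  rw [← foldl_transcript_intermediateMethod p Q h d start Λ n O k]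
  rfl

/-- Decrease of the objective in one iteration. With `w = (1 - 1 / a) y + (1 / a) z'`, the new
approximate solution is `(1 - b / (A + a)) y + (b / (A + a)) w` for `b = a ^ 2`, and `w` differs
from the query point by `(z' - z) / a` only. The upper bound of the oracle is used at `w`, so that
the error `D` enters with the weight `a ^ 2` instead of `A + a`. -/
theorem weighted_objective_le {Q : Set E} {f h : E → ℝ} (hf : ConvexOn ℝ Q f)
    (hh : ConvexOn ℝ Q h) {D Λ : ℝ} {O : E → OracleAnswer E} (hO : IsInexactOracle Q f D Λ O)
    {a A : ℝ} (ha : 1 ≤ a) (hA : 0 ≤ A) (haA : a ^ 2 ≤ A + a) {x y z z' : E} (hy : y ∈ Q)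
    (hz : z ∈ Q) (hz' : z' ∈ Q) (hx : x = (1 - a⁻¹) • y + a⁻¹ • z) :
    (A + a) * (f ((A / (A + a)) • y + (a / (A + a)) • z') +
        h ((A / (A + a)) • y + (a / (A + a)) • z')) ≤
      A * (f y + h y) + a * ((O x).1 + (O x).2 (z' - x) + h z') + Λ / 2 * ‖z' - z‖ ^ 2
        + a ^ 2 * D := by
  have ha0 : 0 < a := by linarith
  have hAa : 0 < A + a := by linarith
  have hi0 : 0 ≤ a⁻¹ := by positivity
  have hi1 : 0 ≤ 1 - a⁻¹ := sub_nonneg.2 (inv_le_one_of_one_le₀ ha)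
  have hxQ : x ∈ Q := hx ▸ hf.1 hy hz hi1 hi0 (by ring)
  set w := (1 - a⁻¹) • y + a⁻¹ • z' with hw
  have hwQ : w ∈ Q := hf.1 hy hz' hi1 hi0 (by ring)
  set b := a ^ 2 / (A + a) with hb
  have hb0 : 0 ≤ b := by positivity
  have hb1 : 0 ≤ 1 - b := sub_nonneg.2 ((div_le_one hAa).2 haA)
  have hy' : (A / (A + a)) • y + (a / (A + a)) • z' = (1 - b) • y + b • w := by
    rw [hw, smul_add, smul_smul, smul_smul, ← add_assoc, ← add_smul]
    congr 2
    · rw [hb]; field_simp; ring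
    · rw [hb]; field_simp
  have hAb : (A + a) * b = a ^ 2 := by rw [hb]; field_simp
  rw [hy']
  have f1 := hf.2 hy hwQ hb1 hb0 (by ring)
  have h1 := hh.2 hy hwQ hb1 hb0 (by ring)
  have h2 := hh.2 hy hz' hi1 hi0 (by ring)
  have f2 := (hO x hxQ w hwQ).2
  have f3 := (hO x hxQ y hy).1
  simp only [smul_eq_mul, ← hw] at f1 h1 h2
  have ew : w - x = a⁻¹ • (z' - z) := by rw [hw, hx]; module
  have ew' : w - x = (1 - a⁻¹) • (y - x) + a⁻¹ • (z' - x) := by rw [hw]; module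
  have elin : (O x).2 (w - x) = (1 - a⁻¹) * (O x).2 (y - x) + a⁻¹ * (O x).2 (z' - x) := by
    rw [ew', map_add, map_smul, map_smul, smul_eq_mul, smul_eq_mul]
  have enorm : a ^ 2 * ‖w - x‖ ^ 2 = ‖z' - z‖ ^ 2 := by
    rw [ew, norm_smul, Real.norm_of_nonneg hi0]; field_simp
  have hai : a ^ 2 * (1 - a⁻¹) = a ^ 2 - a := by field_simp
  have hai' : a ^ 2 * a⁻¹ = a := by field_simp
  have g1 : f w + h w ≤ (1 - a⁻¹) * (f y + h y) +
      a⁻¹ * ((O x).1 + (O x).2 (z' - x) + h z') + Λ / 2 * ‖w - x‖ ^ 2 + D := by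
    have := mul_le_mul_of_nonneg_left f3 hi1
    rw [elin] at f2
    nlinarith
  have g2 : a ^ 2 * (f w + h w) ≤ (a ^ 2 - a) * (f y + h y) +
      a * ((O x).1 + (O x).2 (z' - x) + h z') + Λ / 2 * ‖z' - z‖ ^ 2 + a ^ 2 * D := by
    have := mul_le_mul_of_nonneg_left g1 (sq_nonneg a)
    have e : a ^ 2 * ((1 - a⁻¹) * (f y + h y) + a⁻¹ * ((O x).1 + (O x).2 (z' - x) + h z') +
        Λ / 2 * ‖w - x‖ ^ 2 + D) = (a ^ 2 - a) * (f y + h y) +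
        a * ((O x).1 + (O x).2 (z' - x) + h z') + Λ / 2 * ‖z' - z‖ ^ 2 + a ^ 2 * D := by
      linear_combination (f y + h y) * hai + ((O x).1 + (O x).2 (z' - x) + h z') * hai' +
        Λ / 2 * enorm
    exact this.trans_eq e
  have g3 := mul_le_mul_of_nonneg_left (add_le_add f1 h1) hAa.le
  have g4 : (A + a) * ((1 - b) * f y + b * f w + ((1 - b) * h y + b * h w)) =
      (A + a - a ^ 2) * (f y + h y) + a ^ 2 * (f w + h w) := by
    rw [← hAb]; ring
  linarith

/-- The invariant of the method: `avg` is nearly as good as the minimal value of the model, and the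
model lies below `d + (A / Λ) F`. -/
structure MethodState.Invariant (p : ℝ) (Q : Set E) (f h d : E → ℝ) (Λ D : ℝ)
    (s : MethodState E) : Prop where
  avg_mem : s.avg ∈ Q
  center_mem : s.center ∈ Q
  center_isMinOn : IsMinOn s.model Q s.center
  strongConvexOn : StrongConvexOn Q 1 s.model
  lowerSemicontinuousOn : LowerSemicontinuousOn s.model Q
  objective_le : totalWeight p s.count / Λ * (f s.avg + h s.avg) ≤
    s.model s.center + (∑ i ∈ Finset.range s.count, stepWeight p i ^ 2) / Λ * D
  model_le : ∀ x ∈ Q, s.model x ≤ d x + totalWeight p s.count / Λ * (f x + h x)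

variable [FiniteDimensional ℝ E] {p : ℝ} {Q : Set E} {f h d : E → ℝ} {x₀ : E} {D Λ : ℝ}
  {O : E → OracleAnswer E}

theorem MethodState.Invariant.next (hp0 : 0 ≤ p) (hp1 : p ≤ 1) (hQ : IsCompositeData Q h)
    (hf : ConvexOn ℝ Q f) (hΛ : 0 < Λ) (hO : IsInexactOracle Q f D Λ O) {s : MethodState E}
    (hs : s.Invariant p Q f h d Λ D) :
    (s.next p Q h Λ (O (s.queryPoint p))).Invariant p Q f h d Λ D := by
  have ha := one_le_stepWeight hp0 s.count
  have hA := totalWeight_nonneg hp0 s.count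
  have hα : 0 ≤ stepWeight p s.count / Λ := by positivity
  have hxQ : s.queryPoint p ∈ Q :=
    hQ.convexOn.1 hs.avg_mem hs.center_mem (sub_nonneg.2 (inv_le_one_of_one_le₀ ha))
      (by positivity) (by ring)
  set ans := O (s.queryPoint p) with hans
  have hconv : ConvexOn ℝ Q fun x => stepWeight p s.count / Λ *
      (ans.1 + ans.2 (x - s.queryPoint p) + h x) := by
    refine ConvexOn.smul hα (ConvexOn.add ⟨hQ.convexOn.1, fun u _ v _ r t _ _ hrt => ?_⟩
      hQ.convexOn)
    have e : r • u + t • v - s.queryPoint p =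
        r • (u - s.queryPoint p) + t • (v - s.queryPoint p) := by
      rw [smul_sub, smul_sub, sub_add_sub_comm, ← add_smul, hrt, one_smul]
    simp only [e, map_add, map_smul, smul_eq_mul]
    refine le_of_eq ?_
    linear_combination -ans.1 * hrt
  have hsc : StrongConvexOn Q 1 (s.nextModel p h Λ ans) := by
    have := UniformConvexOn.add hs.strongConvexOn (uniformConvexOn_zero.2 hconv)
    rwa [add_zero] at this
  have hlsc : LowerSemicontinuousOn (s.nextModel p h Λ ans) Q := by
    refine hs.lowerSemicontinuousOn.add ?_
    have hsum : LowerSemicontinuousOn (fun x => ans.1 + ans.2 (x - s.queryPoint p) + h x) Q :=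
      LowerSemicontinuousOn.add
        ((Continuous.lowerSemicontinuous (by fun_prop)).lowerSemicontinuousOn _)
        hQ.lowerSemicontinuousOn
    exact (continuous_const_mul (stepWeight p s.count / Λ)).comp_lowerSemicontinuousOn hsum
      (fun u v huv => mul_le_mul_of_nonneg_left huv hα)
  obtain ⟨hzQ, hzmin⟩ := argminOn_spec
    (hsc.exists_isMinOn hQ.isClosed ⟨_, hs.center_mem⟩ hlsc)
  set z' := argminOn Q (s.nextModel p h Λ ans) with hz'
  have hA' : 0 < totalWeight p s.count + stepWeight p s.count := by linarith
  refine ⟨?_, hzQ, hzmin, hsc, hlsc, ?_, fun x hx => ?_⟩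
  · simp only [MethodState.next, totalWeight_succ]
    exact hQ.convexOn.1 hs.avg_mem hzQ (by positivity) (by positivity) (by field_simp)
  · have hstep := weighted_objective_le hf hQ.convexOn hO ha hA
      (stepWeight_sq_le hp0 hp1 s.count) hs.avg_mem hs.center_mem hzQ (x := s.queryPoint p) rfl
    have hgrow := hs.strongConvexOn.add_sq_le_of_isMinOn hs.center_mem hs.center_isMinOn hzQ
    have hobj := hs.objective_le
    simp only [MethodState.next, totalWeight_succ, Finset.sum_range_succ, ← hz']
    rw [MethodState.nextModel]
    rw [← hans] at hstep
    have h1 := div_le_div_of_nonneg_right hstep hΛ.le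
    have e1 : Λ / 2 * ‖z' - s.center‖ ^ 2 / Λ = 1 / 2 * ‖z' - s.center‖ ^ 2 := by field_simp
    simp only [add_div, e1] at h1
    simp only [mul_div_right_comm _ _ Λ, add_div] at h1
    simp only [add_div]
    linarith
  · have h1 := hs.model_le x hx
    have h2 := (hO _ hxQ x hx).1
    simp only [MethodState.next, totalWeight_succ, MethodState.nextModel]
    rw [← hans] at h2
    have h3 : stepWeight p s.count / Λ * (ans.1 + ans.2 (x - s.queryPoint p) + h x) ≤
        stepWeight p s.count / Λ * (f x + h x) :=
      mul_le_mul_of_nonneg_left (by linarith) hα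
    rw [add_div]
    linarith

theorem methodState_invariant (hp0 : 0 ≤ p) (hp1 : p ≤ 1) (hQ : IsCompositeData Q h)
    (hd : IsProxFunction Q d x₀) (hf : ConvexOn ℝ Q f) (hΛ : 0 < Λ)
    (hO : IsInexactOracle Q f D Λ O) (k : ℕ) :
    (methodState p Q h d x₀ Λ O k).count = k ∧
      (methodState p Q h d x₀ Λ O k).Invariant p Q f h d Λ D := by
  induction k with
  | zero =>
    refine ⟨rfl, hd.center_mem, hd.center_mem, fun x hx => ?_, hd.strongConvexOn,
      hd.continuousOn.lowerSemicontinuousOn, ?_, ?_⟩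
    · simpa [methodState, hd.center_eq_zero] using hd.nonneg x hx
    · simp [methodState, totalWeight, hd.center_eq_zero]
    · simp [methodState, totalWeight]
  | succ k ih =>
    exact ⟨congrArg (· + 1) ih.1, ih.2.next hp0 hp1 hQ hf hΛ hO⟩

/-- The rate of the method in terms of the parameters of the oracle. -/
theorem intermediateMethod_gap_le (hp0 : 0 ≤ p) (hp1 : p ≤ 1) (hQ : IsCompositeData Q h)
    (hd : IsProxFunction Q d x₀) (hf : ConvexOn ℝ Q f) (hΛ : 0 < Λ) (hD : 0 ≤ D)
    (hO : IsInexactOracle Q f D Λ O) {xs : E} (hxs : xs ∈ Q) (n : ℕ) {N : ℕ} (hN : 0 < N) :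
    (intermediateMethod p E Q h d x₀ Λ n).run O N ∈ Q ∧
      (f ((intermediateMethod p E Q h d x₀ Λ n).run O N) +
        h ((intermediateMethod p E Q h d x₀ Λ n).run O N)) - (f xs + h xs) ≤
        4 * Λ * d xs / (N : ℝ) ^ (p + 1) + 4 * (N : ℝ) ^ p * D := by
  rw [intermediateMethod_run]
  obtain ⟨hcount, hinv⟩ := methodState_invariant hp0 hp1 hQ hd hf hΛ hO N
  refine ⟨hinv.avg_mem, ?_⟩
  have h1 := hinv.objective_le
  have h2 := hinv.model_le xs hxs
  have h3 : (methodState p Q h d x₀ Λ O N).model (methodState p Q h d x₀ Λ O N).center ≤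
      (methodState p Q h d x₀ Λ O N).model xs := hinv.center_isMinOn hxs
  rw [hcount] at h1 h2
  set y := (methodState p Q h d x₀ Λ O N).avg
  set g := f y + h y - (f xs + h xs) with hg
  have hN0 : (0 : ℝ) < N := by exact_mod_cast hN
  have hP : 0 < (N : ℝ) ^ (p + 1) := by positivity
  have hA := rpow_div_four_le_totalWeight hp0 hp1 hN
  have hB := sum_stepWeight_sq_le hp0 (N := N)
  have hA0 : 0 < totalWeight p N := by linarith [hP]
  set A := totalWeight p N
  set B := ∑ i ∈ Finset.range N, stepWeight p i ^ 2
  have h4 : A * g ≤ Λ * d xs + B * D := by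
    have h5 : A / Λ * g ≤ d xs + B / Λ * D := by rw [hg]; linarith
    have h6 := mul_le_mul_of_nonneg_left h5 hΛ.le
    have e1 : Λ * (A / Λ * g) = A * g := by field_simp
    have e2 : Λ * (d xs + B / Λ * D) = Λ * d xs + B * D := by field_simp
    linarith
  have hsum : 4 * Λ * d xs / (N : ℝ) ^ (p + 1) + 4 * (N : ℝ) ^ p * D =
      4 / (N : ℝ) ^ (p + 1) * (Λ * d xs + N * ((N : ℝ) ^ p) ^ 2 * D) := by
    rw [Real.rpow_add hN0, Real.rpow_one]; field_simp
  have hnn : 0 ≤ Λ * d xs + N * ((N : ℝ) ^ p) ^ 2 * D := by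
    have := hd.nonneg xs hxs
    positivity
  have h7 : A * g ≤ Λ * d xs + N * ((N : ℝ) ^ p) ^ 2 * D := by
    have := mul_le_mul_of_nonneg_right hB hD
    linarith
  rw [hsum]
  have h8 : g ≤ (Λ * d xs + N * ((N : ℝ) ^ p) ^ 2 * D) / A := by
    rw [le_div_iff₀ hA0]; linarith
  refine h8.trans ?_
  rw [div_eq_inv_mul]
  refine mul_le_mul_of_nonneg_right ?_ hnn
  rw [← inv_div]
  exact inv_anti₀ (by positivity) hA

end Method

/-! ### Hölder smoothness and inexact oracles -/

/-- The term of `effectiveSmoothness` for one exponent `ν`, written with the real constant `l` in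
place of `L ν` and with `θ = (1 - ν) / (1 + ν)`. -/
noncomputable def holderSmoothness (l θ δ : ℝ) : ℝ := l * (l / (2 * δ) * θ) ^ θ

theorem holderSmoothness_nonneg {l θ δ : ℝ} (hl : 0 ≤ l) (hθ : 0 ≤ θ) (hδ : 0 ≤ δ) :
    0 ≤ holderSmoothness l θ δ := by
  unfold holderSmoothness; positivity

/-- `δ ↦ δ * holderSmoothness l θ δ` is a multiple of `δ ^ (1 - θ)`, hence increasing. -/
theorem mul_holderSmoothness_mono {l θ δ δ₀ : ℝ} (hl : 0 ≤ l) (hθ0 : 0 ≤ θ) (hθ1 : θ ≤ 1)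
    (hδ : 0 < δ) (hδ₀ : δ ≤ δ₀) :
    δ * holderSmoothness l θ δ ≤ δ₀ * holderSmoothness l θ δ₀ := by
  have key : ∀ t : ℝ, 0 < t →
      t * holderSmoothness l θ t = l * (l / 2 * θ) ^ θ * t ^ (1 - θ) := by
    intro t ht
    have e : l / (2 * t) * θ = l / 2 * θ / t := by field_simp
    rw [holderSmoothness, e, Real.div_rpow (by positivity) ht.le, Real.rpow_sub ht, Real.rpow_one]
    ring
  rw [key δ hδ, key δ₀ (hδ.trans_le hδ₀)]
  have := Real.rpow_le_rpow hδ.le hδ₀ (sub_nonneg.2 hθ1)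
  exact mul_le_mul_of_nonneg_left this (by positivity)

/-- Weighted arithmetic-geometric means: a Hölder term is dominated by a quadratic one up to an
additive error. -/
theorem mul_rpow_le_holderSmoothness {l ν δ r : ℝ} (hl : 0 ≤ l) (hν : ν ∈ Set.Icc (0 : ℝ) 1)
    (hδ : 0 < δ) (hr : 0 ≤ r) :
    l * r ^ (1 + ν) ≤ holderSmoothness l ((1 - ν) / (1 + ν)) δ * r ^ 2 + 2 * δ := by
  obtain ⟨h0, h1⟩ := hν
  rcases h1.eq_or_lt with rfl | h1
  · norm_num [holderSmoothness]; linarith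
  have hp : 0 < 1 + ν := by linarith
  have hm : 0 < 1 - ν := by linarith
  set θ := (1 - ν) / (1 + ν) with hθ
  have hθ0 : 0 < θ := by positivity
  set A := holderSmoothness l θ δ with hA
  have hA0 : 0 ≤ A := holderSmoothness_nonneg hl hθ0.le hδ.le
  have amgm := Real.geom_mean_le_arith_mean2_weighted (w₁ := (1 + ν) / 2) (w₂ := (1 - ν) / 2)
    (p₁ := 2 * A * r ^ 2 / (1 + ν)) (p₂ := 4 * δ / (1 - ν))
    (by positivity) (by positivity) (by positivity) (by positivity) (by ring)
  have e1 : (1 + ν) / 2 * (2 * A * r ^ 2 / (1 + ν)) + (1 - ν) / 2 * (4 * δ / (1 - ν))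
      = A * r ^ 2 + 2 * δ := by field_simp; ring
  rw [e1] at amgm
  refine le_trans ?_ amgm
  have eA : A ^ ((1 + ν) / 2) = l * (θ / (2 * δ)) ^ ((1 - ν) / 2) := by
    rw [hA, holderSmoothness, show l / (2 * δ) * θ = l * (θ / (2 * δ)) by ring,
      Real.mul_rpow hl (by positivity), Real.mul_rpow hl (by positivity),
      Real.mul_rpow (by positivity) (by positivity), ← Real.rpow_mul hl, ← Real.rpow_mul
      (by positivity), ← mul_assoc, ← Real.rpow_add_of_nonneg hl (by positivity) (by positivity)]
    have e2 : θ * ((1 + ν) / 2) = (1 - ν) / 2 := by rw [hθ]; field_simp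
    rw [e2, show (1 + ν) / 2 + (1 - ν) / 2 = 1 by ring, Real.rpow_one]
  have er : (r ^ 2) ^ ((1 + ν) / 2) = r ^ (1 + ν) := by
    rw [← Real.rpow_natCast, ← Real.rpow_mul hr]; congr 1; push_cast; ring
  have e3 : (2 * A * r ^ 2 / (1 + ν)) ^ ((1 + ν) / 2) * (4 * δ / (1 - ν)) ^ ((1 - ν) / 2)
      = l * r ^ (1 + ν) * (2 / (1 + ν)) := by
    rw [show 2 * A * r ^ 2 / (1 + ν) = (2 / (1 + ν)) * (A * r ^ 2) by ring,
      Real.mul_rpow (by positivity) (by positivity), Real.mul_rpow hA0 (by positivity), eA, er]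
    have e4 : (θ / (2 * δ)) ^ ((1 - ν) / 2) * (4 * δ / (1 - ν)) ^ ((1 - ν) / 2)
        = (2 / (1 + ν)) ^ ((1 - ν) / 2) := by
      rw [← Real.mul_rpow (by positivity) (by positivity)]
      congr 1; rw [hθ]; field_simp; norm_num
    have e5 : (2 / (1 + ν)) ^ ((1 + ν) / 2) * (2 / (1 + ν)) ^ ((1 - ν) / 2) = 2 / (1 + ν) := by
      rw [← Real.rpow_add (by positivity), show (1 + ν) / 2 + (1 - ν) / 2 = 1 by ring,
        Real.rpow_one]
    calc _ = l * r ^ (1 + ν) * ((2 / (1 + ν)) ^ ((1 + ν) / 2) *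
          ((θ / (2 * δ)) ^ ((1 - ν) / 2) * (4 * δ / (1 - ν)) ^ ((1 - ν) / 2))) := by ring
      _ = _ := by rw [e4, e5]
  rw [e3]
  have : 1 ≤ 2 / (1 + ν) := by rw [le_div_iff₀ hp]; linarith
  exact le_mul_of_one_le_right (by positivity) this

theorem effectiveSmoothness_toReal_le {L : ℝ → ℝ≥0∞} {ν δ : ℝ} (hν : ν ∈ Set.Icc (0 : ℝ) 1)
    (hL : L ν ≠ ∞) (hδ : 0 < δ) :
    (effectiveSmoothness L δ).toReal ≤ holderSmoothness (L ν).toReal ((1 - ν) / (1 + ν)) δ := by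
  have hθ : 0 ≤ (1 - ν) / (1 + ν) := div_nonneg (by linarith [hν.2]) (by linarith [hν.1])
  have h : effectiveSmoothness L δ ≤
      ENNReal.ofReal (holderSmoothness (L ν).toReal ((1 - ν) / (1 + ν)) δ) := by
    refine (iInf₂_le ν hν).trans_eq ?_
    have hl : 0 ≤ (L ν).toReal / (2 * δ) := div_nonneg ENNReal.toReal_nonneg (by positivity)
    rw [holderSmoothness, ENNReal.ofReal_mul ENNReal.toReal_nonneg, ENNReal.ofReal_toReal hL,
      ← ENNReal.ofReal_rpow_of_nonneg (mul_nonneg hl hθ) hθ, ENNReal.ofReal_mul hl,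
      ENNReal.ofReal_div_of_pos (y := 2 * δ) (by positivity), ENNReal.ofReal_toReal hL]
  exact ENNReal.toReal_le_of_le_ofReal
    (holderSmoothness_nonneg ENNReal.toReal_nonneg hθ hδ.le) h

section Transfer

variable {E : Type*} [NormedAddCommGroup E] [NormedSpace ℝ E]

/-- The subgradient inequality at `y` replaces integration along the segment, at the cost of a
factor `1 + ν`. -/
theorem IsHolderPart.sub_le {Q : Set E} {f : E → ℝ} {G : E → E →L[ℝ] ℝ} {L : ℝ → ℝ≥0∞}
    (hf : IsHolderPart Q f G L) {ν : ℝ} (hν : ν ∈ Set.Icc (0 : ℝ) 1) (hL : L ν ≠ ∞) {x y : E}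
    (hx : x ∈ Q) (hy : y ∈ Q) :
    f y - f x - G x (y - x) ≤ (L ν).toReal * ‖y - x‖ ^ (1 + ν) := by
  have h1 := hf.subgradient y hy x hx
  have h2 : ‖G y - G x‖ ≤ (L ν).toReal * ‖y - x‖ ^ ν := by
    have h := hf.holder ν hν x hx y hy
    have := ENNReal.toReal_mono (ENNReal.mul_ne_top hL
      (ENNReal.rpow_ne_top_of_nonneg hν.1 enorm_ne_top)) h
    simpa [ENNReal.toReal_mul, ← ENNReal.toReal_rpow] using this
  have h3 : (G y - G x) (y - x) ≤ ‖G y - G x‖ * ‖y - x‖ :=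
    (le_abs_self _).trans ((G y - G x).le_opNorm _)
  have h4 : ‖G y - G x‖ * ‖y - x‖ ≤ (L ν).toReal * ‖y - x‖ ^ ν * ‖y - x‖ :=
    mul_le_mul_of_nonneg_right h2 (norm_nonneg _)
  have h5 : ‖y - x‖ ^ (1 + ν) = ‖y - x‖ ^ ν * ‖y - x‖ := by
    rw [add_comm, Real.rpow_add_of_nonneg (norm_nonneg _) hν.1 zero_le_one, Real.rpow_one]
  have h6 : G y (x - y) = - G y (y - x) := by rw [← map_neg, neg_sub]
  rw [h5, ← mul_assoc]
  simp only [sub_apply] at h3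
  linarith

/-- An oracle that is more exact than `δ₀` has a larger smoothness parameter, but it is also an
oracle with errors and parameters comparable to those for `δ₀`. The functional `(O x).2` is
compared with the subgradient `G x` at the point `x + t • (y - x)`, where `t = δ / δ₀` makes use of
`δ * L(δ) ≤ δ₀ * L(δ₀)`. -/
theorem IsInexactOracle.of_le {Q : Set E} {f : E → ℝ} {G : E → E →L[ℝ] ℝ} {L : ℝ → ℝ≥0∞}
    (hQ : Convex ℝ Q) (hf : IsHolderPart Q f G L) {ν : ℝ} (hν : ν ∈ Set.Icc (0 : ℝ) 1)
    (hL : L ν ≠ ∞) {δ δ₀ Λ : ℝ} (hδ : 0 < δ) (hδ₀ : δ ≤ δ₀)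
    (hΛ : 3 * holderSmoothness (L ν).toReal ((1 - ν) / (1 + ν)) δ₀ ≤ Λ) {O : E → OracleAnswer E}
    (hO : IsInexactOracle Q f δ (effectiveSmoothness L δ).toReal O) :
    IsInexactOracle Q f (4 * δ₀) Λ O := by
  intro x hx y hy
  refine ⟨(hO x hx y hy).1, ?_⟩
  have hδ₀' : 0 < δ₀ := hδ.trans_le hδ₀
  have hν1 : 0 < 1 + ν := by linarith [hν.1]
  have hθ0 : 0 ≤ (1 - ν) / (1 + ν) := div_nonneg (by linarith [hν.2]) hν1.le
  have hθ1 : (1 - ν) / (1 + ν) ≤ 1 := (div_le_one hν1).2 (by linarith [hν.1])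
  have hmono := mul_holderSmoothness_mono (ENNReal.toReal_nonneg (a := L ν)) hθ0 hθ1 hδ hδ₀
  have hEff := effectiveSmoothness_toReal_le hν hL hδ
  have hyoung := mul_rpow_le_holderSmoothness (ENNReal.toReal_nonneg (a := L ν)) hν hδ₀'
    (norm_nonneg (y - x))
  have hexact := hf.sub_le hν hL hx hy
  set A := holderSmoothness (L ν).toReal ((1 - ν) / (1 + ν)) δ₀
  set B := holderSmoothness (L ν).toReal ((1 - ν) / (1 + ν)) δ
  set t := δ / δ₀ with ht
  have ht0 : 0 < t := by positivity
  have ht1 : t ≤ 1 := (div_le_one hδ₀').2 hδ₀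
  have htδ : δ = t * δ₀ := by rw [ht, div_mul_cancel₀ _ hδ₀'.ne']
  have htB : t * B ≤ A := by
    refine le_of_mul_le_mul_left (le_of_eq_of_le ?_ hmono) hδ₀'
    rw [htδ]; ring
  have hmem : x + t • (y - x) ∈ Q := hQ.add_smul_sub_mem hx hy ⟨ht0.le, ht1⟩
  have h1 := (hO x hx _ hmem).2
  have h2 := hf.subgradient x hx _ hmem
  have h3 := (hO x hx x hx).2
  simp only [add_sub_cancel_left, map_smul, smul_eq_mul, norm_smul, Real.norm_of_nonneg ht0.le,
    mul_pow] at h1 h2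
  simp only [sub_self, map_zero, norm_zero] at h3
  have h0 := (hO x hx x hx).1
  simp only [sub_self, map_zero] at h0
  set r := ‖y - x‖ with hr
  have hr2 : 0 ≤ r ^ 2 := by positivity
  -- the gradients differ by at most `A / 2 * r ^ 2 + δ₀` in the direction `y - x`
  have h4 : G x (y - x) - (O x).2 (y - x) ≤ A / 2 * r ^ 2 + δ₀ := by
    refine le_of_mul_le_mul_left ?_ ht0
    have h5 : (effectiveSmoothness L δ).toReal / 2 * (t ^ 2 * r ^ 2)
        ≤ B / 2 * (t ^ 2 * r ^ 2) := by gcongr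
    have h6 : t * B * (t * r ^ 2 / 2) ≤ A * (t * r ^ 2 / 2) := by gcongr
    nlinarith
  have h7 : 3 * A / 2 * r ^ 2 ≤ Λ / 2 * r ^ 2 := by gcongr
  have h8 : f x - (O x).1 ≤ δ := by linarith
  linarith

end Transfer

/-! ### Choice of the parameters -/

/-- The number of iterations is tied to one exponent `ν` that nearly attains the infimum `inf g` and
has `L ν < ∞`. A finite `g ν` need not give a finite `L ν` when another factor of `g` vanishes,
hence the two alternatives. -/
theorem exists_exponent_iterations {L g : ℝ → ℝ≥0∞} (hL : ∃ ν ∈ Set.Icc (0 : ℝ) 1, L ν ≠ ∞)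
    (hg : (∀ ν ∈ Set.Icc (0 : ℝ) 1, L ν = ∞ → g ν = ∞) ∨ ∀ ν ∈ Set.Icc (0 : ℝ) 1, g ν = 0) :
    ∃ ν ∈ Set.Icc (0 : ℝ) 1, L ν ≠ ∞ ∧ ∃ n : ℕ, 0 < n ∧ 2048 * (g ν).toReal ≤ n ∧
      (n : ℝ≥0∞) ≤ ENNReal.ofReal 5000 * max 1 (⨅ ν ∈ Set.Icc (0 : ℝ) 1, g ν) := by
  set m := max 1 (⨅ ν ∈ Set.Icc (0 : ℝ) 1, g ν) with hm
  have hm1 : 1 ≤ m := le_max_left _ _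
  obtain ⟨ν, hν, hLν, hgν⟩ : ∃ ν ∈ Set.Icc (0 : ℝ) 1, L ν ≠ ∞ ∧ g ν ≤ 2 * m := by
    by_cases hm_top : m = ∞
    · obtain ⟨ν, hν, hLν⟩ := hL
      exact ⟨ν, hν, hLν, by simp [hm_top]⟩
    rcases hg with hg | hg
    · have hlt : ⨅ ν ∈ Set.Icc (0 : ℝ) 1, g ν < 2 * m := by
        refine (le_max_right 1 _).trans_lt ?_
        rw [← hm, two_mul]
        exact ENNReal.lt_add_right hm_top (zero_lt_one.trans_le hm1).ne'
      simp only [iInf_lt_iff] at hlt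
      obtain ⟨ν, hν, hlt⟩ := hlt
      exact ⟨ν, hν, fun h => by simp [hg ν hν h] at hlt, hlt.le⟩
    · obtain ⟨ν, hν, hLν⟩ := hL
      exact ⟨ν, hν, hLν, by simp [hg ν hν]⟩
  refine ⟨ν, hν, hLν, ⌈2048 * max 1 (g ν).toReal⌉₊, ?_, ?_, ?_⟩
  · exact Nat.ceil_pos.2 (by positivity)
  · exact (mul_le_mul_of_nonneg_left (le_max_right _ _) (by norm_num)).trans (Nat.le_ceil _)
  · set t := max 1 (g ν).toReal with ht
    have ht1 : 1 ≤ t := le_max_left _ _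
    have h1 : (⌈2048 * t⌉₊ : ℝ) ≤ 2500 * t := by
      have := Nat.ceil_lt_add_one (show 0 ≤ 2048 * t by positivity)
      linarith
    have h2 : ENNReal.ofReal t ≤ 2 * m := by
      rw [ht, ENNReal.ofReal_max, ENNReal.ofReal_one]
      refine max_le ?_ (ENNReal.ofReal_toReal_le.trans hgν)
      exact hm1.trans (le_mul_of_one_le_left' one_le_two)
    calc ((⌈2048 * t⌉₊ : ℕ) : ℝ≥0∞) = ENNReal.ofReal (⌈2048 * t⌉₊ : ℝ) :=
          (ENNReal.ofReal_natCast _).symm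
      _ ≤ ENNReal.ofReal (2500 * t) := ENNReal.ofReal_le_ofReal h1
      _ = ENNReal.ofReal 2500 * ENNReal.ofReal t := ENNReal.ofReal_mul (by norm_num)
      _ ≤ ENNReal.ofReal 2500 * (2 * m) := by gcongr
      _ = ENNReal.ofReal 5000 * m := by
          rw [← mul_assoc, ← ENNReal.ofReal_ofNat 2, ← ENNReal.ofReal_mul (by norm_num)]
          norm_num

/-- With the inexactness `ε / (64 n ^ p)` the smoothness parameter grows like `n ^ (p θ)`, where
`θ = (1 - ν) / (1 + ν)`, and `(p + 1) - p θ = (1 + 2 p ν + ν) / (1 + ν)` is the inverse of the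
exponent in the bound for the number `n` of iterations. The factor `2048` is large enough for the
`3 / 16` that a run needs: there the left-hand side enters with the factor `12`. -/
theorem holderSmoothness_mul_le {p ν l ρ ε n : ℝ} (hp : 0 ≤ p) (hν : ν ∈ Set.Icc (0 : ℝ) 1)
    (hl : 0 ≤ l) (hρ : 0 ≤ ρ) (hε : 0 < ε) (hn : 0 < n)
    (hnU : 2048 * (l ^ (2 / (1 + ν)) * ρ / ε ^ ((1 - ν) / (1 + ν))) ^
      ((1 + ν) / (1 + 2 * p * ν + ν)) ≤ n) :
    holderSmoothness l ((1 - ν) / (1 + ν)) (ε / (64 * n ^ p)) * ρ ≤ n ^ (p + 1) / 64 := by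
  obtain ⟨h0, h1⟩ := hν
  have hp1 : 0 < 1 + ν := by linarith
  have hpν : 0 ≤ p * ν := mul_nonneg hp h0
  have hp2 : 0 < 1 + 2 * p * ν + ν := by linarith
  set θ := (1 - ν) / (1 + ν) with hθ
  have hθ0 : 0 ≤ θ := div_nonneg (by linarith) hp1.le
  have hθ1 : θ ≤ 1 := (div_le_one hp1).2 (by linarith)
  have hθ2 : 2 / (1 + ν) = 1 + θ := by rw [hθ]; field_simp; ring
  rw [hθ2] at hnU
  set U := l ^ (1 + θ) * ρ / ε ^ θ with hU
  have hU0 : 0 ≤ U := by positivity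
  have hnp : 0 < n ^ p := by positivity
  set s := (1 + 2 * p * ν + ν) / (1 + ν) with hs
  have hs1 : 1 ≤ s := by rw [hs, le_div_iff₀ hp1]; linarith
  have hsθ : s + p * θ = p + 1 := by rw [hs, hθ]; field_simp; ring
  have hA : holderSmoothness l θ (ε / (64 * n ^ p)) ≤ 32 * l ^ (1 + θ) * n ^ (p * θ) / ε ^ θ := by
    have e : l / (2 * (ε / (64 * n ^ p))) * θ = 32 * θ * (l * n ^ p / ε) := by
      field_simp; ring
    have h32 : (32 * θ) ^ θ ≤ 32 := by
      calc (32 * θ) ^ θ ≤ 32 ^ θ :=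
            Real.rpow_le_rpow (by positivity) (by linarith) hθ0
        _ ≤ 32 := by
            simpa using Real.rpow_le_rpow_of_exponent_le (by norm_num : (1 : ℝ) ≤ 32) hθ1
    rw [holderSmoothness, e, Real.mul_rpow (by positivity) (by positivity),
      Real.div_rpow (by positivity) hε.le, Real.mul_rpow hl hnp.le, ← Real.rpow_mul hn.le,
      Real.rpow_add_of_nonneg hl zero_le_one hθ0, Real.rpow_one]
    calc l * ((32 * θ) ^ θ * (l ^ θ * n ^ (p * θ) / ε ^ θ))
        ≤ l * (32 * (l ^ θ * n ^ (p * θ) / ε ^ θ)) := by gcongr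
      _ = _ := by ring
  have hUn : U ≤ n ^ s / 2048 := by
    have h3 : U ^ s⁻¹ ≤ n / 2048 := by
      rw [hs, inv_div, le_div_iff₀ (by norm_num)]; linarith
    have h4 : U = (U ^ s⁻¹) ^ s := by
      rw [← Real.rpow_mul hU0, inv_mul_cancel₀ (by linarith), Real.rpow_one]
    rw [h4]
    calc (U ^ s⁻¹) ^ s ≤ (n / 2048) ^ s :=
          Real.rpow_le_rpow (by positivity) h3 (by linarith)
      _ = n ^ s / 2048 ^ s := Real.div_rpow hn.le (by norm_num) _
      _ ≤ n ^ s / 2048 := by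
          gcongr
          simpa using Real.rpow_le_rpow_of_exponent_le (by norm_num : (1 : ℝ) ≤ 2048) hs1
  calc holderSmoothness l θ (ε / (64 * n ^ p)) * ρ
      ≤ 32 * l ^ (1 + θ) * n ^ (p * θ) / ε ^ θ * ρ := by gcongr
    _ = 32 * U * n ^ (p * θ) := by rw [hU]; ring
    _ ≤ 32 * (n ^ s / 2048) * n ^ (p * θ) := by gcongr
    _ = n ^ (s + p * θ) / 64 := by rw [Real.rpow_add hn]; ring
    _ = n ^ (p + 1) / 64 := by rw [hsθ]

section Rates

variable {E : Type*} [NormedAddCommGroup E] [NormedSpace ℝ E] {p : ℝ}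

/-- One run of the method, with a smoothness parameter that serves all problems of the class and all
inexactness levels up to `ε / (64 n ^ p)`. The number `ρ` measures the distance to the solution by
`d xs ≤ ρ * D`. -/
theorem exists_smoothness_run_le [FiniteDimensional ℝ E] (hp : p ∈ Set.Icc (0 : ℝ) 1) {Q : Set E}
    {h : E → ℝ} (hQ : IsCompositeData Q h) {L : ℝ → ℝ≥0∞} {ν : ℝ}
    (hν : ν ∈ Set.Icc (0 : ℝ) 1) (hL : L ν ≠ ∞) {ρ ε : ℝ} (hρ : 0 ≤ ρ) (hε : 0 < ε) {n : ℕ}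
    (hn : 0 < n) (hnU : 2048 * ((L ν).toReal ^ (2 / (1 + ν)) * ρ / ε ^ ((1 - ν) / (1 + ν))) ^
      ((1 + ν) / (1 + 2 * p * ν + ν)) ≤ n) :
    ∃ Λ : ℝ, 0 < Λ ∧ ∀ (f : E → ℝ) (G : E → E →L[ℝ] ℝ) (xs : E) (δ : ℝ) (O : E → OracleAnswer E)
      (d : E → ℝ) (x₀ : E) (D : ℝ), IsHolderPart Q f G L → xs ∈ Q →
      0 < δ → δ ≤ ε / (64 * (n : ℝ) ^ p) →
      IsInexactOracle Q f δ (effectiveSmoothness L δ).toReal O →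
      IsProxFunction Q d x₀ → 0 ≤ D → d xs ≤ ρ * D →
      (intermediateMethod p E Q h d x₀ Λ n).run O n ∈ Q ∧
        (f ((intermediateMethod p E Q h d x₀ Λ n).run O n) +
          h ((intermediateMethod p E Q h d x₀ Λ n).run O n)) - (f xs + h xs) ≤
          D / 4 + ε / 4 := by
  have hn0 : (0 : ℝ) < n := by exact_mod_cast hn
  have hn1 : (1 : ℝ) ≤ n := by exact_mod_cast hn
  have hP1 : 1 ≤ (n : ℝ) ^ (p + 1) := Real.one_le_rpow hn1 (by linarith [hp.1])
  have hA := holderSmoothness_mul_le hp.1 hν ENNReal.toReal_nonneg hρ hε hn0 hnU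
  have hA0 := holderSmoothness_nonneg (ENNReal.toReal_nonneg (a := L ν))
    (div_nonneg (by linarith [hν.2]) (by linarith [hν.1]) : 0 ≤ (1 - ν) / (1 + ν))
    (by positivity : 0 ≤ ε / (64 * (n : ℝ) ^ p))
  set δ₀ := ε / (64 * (n : ℝ) ^ p) with hδ₀
  set A := holderSmoothness (L ν).toReal ((1 - ν) / (1 + ν)) δ₀
  -- the second term only serves to make the parameter positive
  set κ := 1 / (64 * (ρ + 1)) with hκ
  have hκ0 : 0 < κ := by positivity
  have hκρ : κ * ρ ≤ 1 / 64 := by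
    rw [hκ, div_mul_eq_mul_div, div_le_div_iff₀ (by positivity) (by norm_num)]; linarith
  have hΛ0 : 0 < 3 * A + κ := by positivity
  refine ⟨3 * A + κ, hΛ0, fun f G xs δ O d x₀ D hf hxs hδ hδle hO hd hD hdD => ?_⟩
  have hO' := hO.of_le hQ.convexOn.1 hf hν hL hδ hδle (le_add_of_nonneg_right hκ0.le)
  obtain ⟨hmem, hgap⟩ := intermediateMethod_gap_le hp.1 hp.2 hQ hd hf.convexOn hΛ0
    (by positivity) hO' hxs n hn
  refine ⟨hmem, hgap.trans (add_le_add ?_ ?_)⟩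
  · have hd0 := hd.nonneg xs hxs
    rw [div_le_iff₀ (by positivity)]
    calc 4 * (3 * A + κ) * d xs ≤ 4 * (3 * A + κ) * (ρ * D) := by gcongr
      _ = (12 * (A * ρ) + 4 * (κ * ρ)) * D := by ring
      _ ≤ (1 / 4 * (n : ℝ) ^ (p + 1)) * D := by
          refine mul_le_mul_of_nonneg_right ?_ hD
          linarith
      _ = D / 4 * (n : ℝ) ^ (p + 1) := by ring
  · rw [hδ₀]
    refine le_of_eq ?_
    field_simp; norm_num

end Rates

/-! ### The two complexity bounds -/

section Bounds

variable {E : Type*} [NormedAddCommGroup E] [NormedSpace ℝ E]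

/-- Although the derivative within `Q` need not be unique, `fderivWithin` is `0` wherever `0` is a
derivative. -/
theorem IsProxFunction.bregman_center {Q : Set E} {d : E → ℝ} {x₀ : E}
    (hd : IsProxFunction Q d x₀) (x : E) : bregman Q d x x₀ = d x := by
  have h : fderivWithin ℝ d Q x₀ = 0 := by
    rw [fderivWithin, if_pos hd.grad_center_eq_zero]
  rw [bregman, h, hd.center_eq_zero]
  simp

theorem IsProxFunction.le_proxRatio_mul {Q : Set E} {d : E → ℝ} {x₀ : E}
    (hd : IsProxFunction Q d x₀) (hω : proxRatio Q d x₀ ≠ ∞) {x : E} (hx : x ∈ Q) :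
    d x ≤ (proxRatio Q d x₀).toReal / 2 * ‖x - x₀‖ ^ 2 := by
  by_cases hxx : x = x₀
  · simp [hxx, hd.center_eq_zero]
  have hpos : 0 < ‖x - x₀‖ := norm_pos_iff.2 (sub_ne_zero.2 hxx)
  have h : ENNReal.ofReal (2 * bregman Q d x x₀ / ‖x - x₀‖ ^ 2) ≤ proxRatio Q d x₀ :=
    le_iSup₂ (f := fun x _ => ENNReal.ofReal (2 * bregman Q d x x₀ / ‖x - x₀‖ ^ 2)) x hx
  have h' := (ENNReal.ofReal_le_iff_le_toReal hω).1 h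
  rw [hd.bregman_center, div_le_iff₀ (by positivity)] at h'
  linarith

/-- In the convex case, the base of the complexity bound with exponent `2 / (1 + 2pν + ν)` is
rewritten with the exponent `(1 + ν) / (1 + 2pν + ν)`. -/
theorem convexComplexity_term_toReal {p ν R ε : ℝ} {l : ℝ≥0∞} (hν : 0 ≤ ν) (hR : 0 ≤ R)
    (hε : 0 < ε) :
    ((l * ENNReal.ofReal (R ^ (1 + ν)) / ENNReal.ofReal ε) ^ (2 / (1 + 2 * p * ν + ν))).toReal =
      (l.toReal ^ (2 / (1 + ν)) * (R ^ 2 / ε) / ε ^ ((1 - ν) / (1 + ν))) ^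
        ((1 + ν) / (1 + 2 * p * ν + ν)) := by
  have hp1 : 0 < 1 + ν := by linarith
  have hl := ENNReal.toReal_nonneg (a := l)
  have h1 : l.toReal ^ (2 / (1 + ν)) * (R ^ 2 / ε) / ε ^ ((1 - ν) / (1 + ν)) =
      (l.toReal * R ^ (1 + ν) / ε) ^ (2 / (1 + ν)) := by
    have e1 : (R ^ (1 + ν)) ^ (2 / (1 + ν)) = R ^ 2 := by
      rw [← Real.rpow_mul hR, mul_div_cancel₀ _ hp1.ne', Real.rpow_two]
    have e2 : ε ^ (2 / (1 + ν)) = ε * ε ^ ((1 - ν) / (1 + ν)) := by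
      rw [show 2 / (1 + ν) = 1 + (1 - ν) / (1 + ν) by field_simp; ring, Real.rpow_add hε,
        Real.rpow_one]
    rw [Real.div_rpow (by positivity) hε.le, Real.mul_rpow hl (by positivity), e1, e2]
    field_simp
  rw [h1, ← Real.rpow_mul (by positivity), div_mul_div_cancel₀ hp1.ne', ← ENNReal.toReal_rpow,
    ENNReal.toReal_div, ENNReal.toReal_mul, ENNReal.toReal_ofReal (by positivity),
    ENNReal.toReal_ofReal hε.le]

theorem stronglyConvexComplexity_term_toReal {p ν μ ε : ℝ} {l ω : ℝ≥0∞} (hμ : 0 < μ)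
    (hε : 0 < ε) :
    ((l ^ (2 / (1 + ν)) * ω / ENNReal.ofReal (μ * ε ^ ((1 - ν) / (1 + ν)))) ^
        ((1 + ν) / (1 + 2 * p * ν + ν))).toReal =
      (l.toReal ^ (2 / (1 + ν)) * (ω.toReal / μ) / ε ^ ((1 - ν) / (1 + ν))) ^
        ((1 + ν) / (1 + 2 * p * ν + ν)) := by
  rw [← ENNReal.toReal_rpow, ENNReal.toReal_div, ENNReal.toReal_mul, ← ENNReal.toReal_rpow,
    ENNReal.toReal_ofReal (by positivity)]
  congr 1
  field_simp

/-- If a run from `y` ends with a gap of at most a quarter of `μ / 2 * ‖xs - y‖ ^ 2`, up to an error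
`ε / 4`, then the gap decreases geometrically over the runs: by strong convexity
`μ / 2 * ‖xs - y‖ ^ 2` is at most the gap at `y`. The errors add up to at most `ε / 3`. -/
theorem restarted_gap_le {M : GradientScheme E} {Q : Set E} {h d : E → ℝ} {x₀ : E} {Λ : ℝ} {n : ℕ}
    {O : E → OracleAnswer E} {f : E → ℝ} {xs : E} {μ R ε : ℝ} (hμ : 0 < μ) (hε : 0 < ε)
    (hx₀ : x₀ ∈ Q) (hsc : StrongConvexOn Q μ (fun x => f x + h x)) (hxs : xs ∈ Q)
    (hmin : IsMinOn (fun x => f x + h x) Q xs) (hR : ‖x₀ - xs‖ ≤ R)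
    (hrun : ∀ y ∈ Q, (M Q h (shiftProx d x₀ y) y Λ n).run O n ∈ Q ∧
      (f ((M Q h (shiftProx d x₀ y) y Λ n).run O n) +
        h ((M Q h (shiftProx d x₀ y) y Λ n).run O n)) - (f xs + h xs) ≤
        μ / 2 * ‖xs - y‖ ^ 2 / 4 + ε / 4) (k : ℕ) :
    restarted M Q h d x₀ Λ n O (k + 1) ∈ Q ∧
      (f (restarted M Q h d x₀ Λ n O (k + 1)) + h (restarted M Q h d x₀ Λ n O (k + 1)))
        - (f xs + h xs) ≤ (1 / 4) ^ (k + 1) * (μ * R ^ 2 / 2) + ε / 3 := by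
  induction k with
  | zero =>
    obtain ⟨h1, h2⟩ := hrun x₀ hx₀
    refine ⟨h1, h2.trans ?_⟩
    have h3 : ‖xs - x₀‖ ^ 2 ≤ R ^ 2 := by
      rw [norm_sub_rev]; exact pow_le_pow_left₀ (norm_nonneg _) hR 2
    have h4 := mul_le_mul_of_nonneg_left h3 hμ.le
    linarith
  | succ k ih =>
    obtain ⟨hy, hgap⟩ := ih
    obtain ⟨h1, h2⟩ := hrun _ hy
    refine ⟨h1, h2.trans ?_⟩
    have h3 := hsc.add_sq_le_of_isMinOn hxs hmin hy
    rw [norm_sub_rev] at h3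
    rw [pow_succ _ (k + 1)]
    linarith

variable [FiniteDimensional ℝ E]

theorem hasIntermediateRate_intermediateMethod {p : ℝ} (hp : p ∈ Set.Icc (0 : ℝ) 1) :
    HasIntermediateRate p 5000 (1 / 64) (intermediateMethod p E) := by
  intro Q h d x₀ L R ε hQ hd hL hR hε
  have hexp : ∀ ν ∈ Set.Icc (0 : ℝ) 1, 0 < 1 + 2 * p * ν + ν := fun ν hν => by
    have := mul_nonneg hp.1 hν.1
    linarith [hν.1]
  obtain ⟨ν, hν, hLν, n, hn, hnT, hnC⟩ := exists_exponent_iterations (g := fun ν =>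
      (L ν * ENNReal.ofReal (R ^ (1 + ν)) / ENNReal.ofReal ε) ^ (2 / (1 + 2 * p * ν + ν))) hL (by
    rcases hR.eq_or_lt with rfl | hR
    · refine Or.inr fun ν hν => ?_
      have := hexp ν hν
      rw [Real.zero_rpow (by linarith [hν.1]), ENNReal.ofReal_zero, mul_zero, ENNReal.zero_div,
        ENNReal.zero_rpow_of_pos (by positivity)]
    · refine Or.inl fun ν hν htop => ?_
      have := hexp ν hν
      rw [htop, ENNReal.top_mul (by simpa using Real.rpow_pos_of_pos hR _),
        ENNReal.top_div_of_ne_top ENNReal.ofReal_ne_top, ENNReal.top_rpow_of_pos (by positivity)])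
  rw [convexComplexity_term_toReal hν.1 hR hε] at hnT
  obtain ⟨Λ, hΛ, hrun⟩ := exists_smoothness_run_le hp hQ hν hLν
    (ρ := R ^ 2 / ε) (by positivity) hε hn hnT
  refine ⟨Λ, n, hΛ, hn, hnC, fun f G xs δ O hf hxs _ hV hδ hδε hO => ?_⟩
  rw [hd.bregman_center] at hV
  have hδ' : δ ≤ ε / (64 * (n : ℝ) ^ p) := hδε.trans_eq (by field_simp)
  obtain ⟨hmem, hgap⟩ := hrun f G xs δ O d x₀ ε hf hxs hδ hδ' hO hd hε.le
    (hV.trans_eq (by field_simp))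
  exact ⟨hmem, by linarith⟩

theorem hasRestartRate_intermediateMethod {p : ℝ} (hp : p ∈ Set.Icc (0 : ℝ) 1) :
    HasRestartRate p 5000 (1 / 64) (intermediateMethod p E) := by
  intro Q h d x₀ L μ R ε hQ hx₀ hd hω hL hμ hR hε
  have hexp : ∀ ν ∈ Set.Icc (0 : ℝ) 1, 0 < 1 + 2 * p * ν + ν := fun ν hν => by
    have := mul_nonneg hp.1 hν.1
    linarith [hν.1]
  set ω := restartRatio Q d x₀ with hωdef
  obtain ⟨ν, hν, hLν, n, hn, hnT, hnC⟩ := exists_exponent_iterations (g := fun ν =>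
      (L ν ^ (2 / (1 + ν)) * ω / ENNReal.ofReal (μ * ε ^ ((1 - ν) / (1 + ν)))) ^
        ((1 + ν) / (1 + 2 * p * ν + ν))) hL (by
    by_cases hω0 : ω = 0
    · refine Or.inr fun ν hν => ?_
      have := hexp ν hν
      have : 0 < 1 + ν := by linarith [hν.1]
      rw [hω0, mul_zero, ENNReal.zero_div, ENNReal.zero_rpow_of_pos (by positivity)]
    · refine Or.inl fun ν hν htop => ?_
      have := hexp ν hν
      have : 0 < 1 + ν := by linarith [hν.1]
      rw [htop, ENNReal.top_rpow_of_pos (by positivity), ENNReal.top_mul hω0,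
        ENNReal.top_div_of_ne_top ENNReal.ofReal_ne_top, ENNReal.top_rpow_of_pos (by positivity)])
  rw [stronglyConvexComplexity_term_toReal hμ hε] at hnT
  obtain ⟨Λ, hΛ, hrun⟩ := exists_smoothness_run_le hp hQ hν hLν
    (ρ := ω.toReal / μ) (by positivity) hε hn hnT
  set k := max 1 ⌈Real.log (μ * R ^ 2 / ε)⌉₊ with hk
  have hk1 : 1 ≤ k := le_max_left _ _
  refine ⟨Λ, n, k, hΛ, hn, hk1, ?_, fun f G xs δ O hf hsc hxs hmin hRxs hδ hδε hO => ?_⟩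
  · rw [Nat.cast_mul, mul_comm]
    exact mul_le_mul_left hnC _
  have hn0 : (0 : ℝ) < n := by exact_mod_cast hn
  have hδ' : δ ≤ ε / (64 * (n : ℝ) ^ p) := by
    refine hδε.trans ?_
    have h1 : (n : ℝ) ^ p ≤ ((k * n : ℕ) : ℝ) ^ p :=
      Real.rpow_le_rpow hn0.le (by exact_mod_cast Nat.le_mul_of_pos_left n hk1) hp.1
    calc 1 / 64 * ε / ((k * n : ℕ) : ℝ) ^ p ≤ 1 / 64 * ε / (n : ℝ) ^ p := by gcongr
      _ = _ := by field_simp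
  have hstep := restarted_gap_le (M := intermediateMethod p E) (d := d) (Λ := Λ) (n := n) (O := O)
    hμ hε hx₀ hsc hxs hmin hRxs (fun y hy => by
      refine hrun f G xs δ O _ y _ hf hxs hδ hδ' hO (hd y hy) (by positivity) ?_
      have hle : proxRatio Q (shiftProx d x₀ y) y ≤ ω :=
        le_iSup₂ (f := fun y _ => proxRatio Q (shiftProx d x₀ y) y) y hy
      refine ((hd y hy).le_proxRatio_mul (ne_top_of_le_ne_top hω hle) hxs).trans ?_
      have h1 := ENNReal.toReal_mono hω hle
      calc _ ≤ ω.toReal / 2 * ‖xs - y‖ ^ 2 := by gcongr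
        _ = _ := by field_simp) (k - 1)
  rw [Nat.sub_add_cancel hk1] at hstep
  refine ⟨hstep.1, hstep.2.trans ?_⟩
  have hpow : (1 / 4) ^ k * (μ * R ^ 2) ≤ ε := by
    rcases hR.eq_or_lt with rfl | hR
    · simp [hε.le]
    have h1 : Real.log (μ * R ^ 2 / ε) ≤ k :=
      (Nat.le_ceil _).trans (by exact_mod_cast le_max_right _ _)
    have h2 : μ * R ^ 2 / ε ≤ 4 ^ k := by
      calc μ * R ^ 2 / ε ≤ Real.exp k := (Real.log_le_iff_le_exp (by positivity)).1 h1
        _ = Real.exp 1 ^ k := by rw [← Real.exp_nat_mul, mul_one]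
        _ ≤ 4 ^ k := by
            gcongr
            linarith [Real.exp_one_lt_three]
    rw [div_le_iff₀ hε] at h2
    rw [one_div, inv_pow, inv_mul_le_iff₀ (by positivity)]
    exact h2
  linarith

end Bounds

theorem mainTheorem1 :
    ∃ C c : ℝ, 0 < C ∧ 0 < c ∧
      ∀ p ∈ Set.Icc (0 : ℝ) 1,
        ∀ (E : Type*) [NormedAddCommGroup E] [NormedSpace ℝ E] [FiniteDimensional ℝ E],
          ∃ M : GradientScheme E,
            HasIntermediateRate p C c M ∧ HasRestartRate p C c M :=
  ⟨5000, 1 / 64, by norm_num, by norm_num, fun p hp E _ _ _ =>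
    ⟨intermediateMethod p E, hasIntermediateRate_intermediateMethod hp,
      hasRestartRate_intermediateMethod hp⟩⟩
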